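/- There exist an absolute constant $c>0$ and, for every integer $k\ge 3$, a convex $k$-gon $\mathcal P_k\subset\mathbb R^2$ (a closed polygonal curve, the boundary of the convex hull of its $k$ vertices, which are in convex position) with the origin in its interior, and a bounded set $B_k\subset\mathbb R^2$, such that the following hold. 1. Each $\mathcal P_k$ is a lattice polygon up to scaling: there is a positive integer $m_k$ such that all vertices of $\mathcal P_k$ lie in $m_k^{-1}\mathbb Z^2$. 2. As $k\to\infty$, $\mathcal P_k$ converges in the Hausdorff metric to the unit circle $\{x\in\mathbb R^2:|x|=1\}$. 3. For every $k\ge 3$ and every $x\in[0,1]^2$, the set $B_k$ contains the vertices of a scaled and rotated copy of $\mathcal P_k$ centred at $x$: there are $s>0$ and a rotation $R$ about the origin with $x+sRv\in B_k$ for every vertex $v$ of $\mathcal P_k$. 4. For every $k\ge 3$, $$\dim_M B_k\le 2-\frac{c}{\log k}.$$ Here $\dim_M E=\limsup_{\epsilon\to0^+}\frac{\log N_E(\epsilon)}{\log(1/\epsilon)}$ is the Minkowski (upper box) dimension, where $N_E(\epsilon)$ is the least positive number of axis-parallel boxes of side length at most $\epsilon$ that cover $E$. -/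

import Mathlib

open Filter Topology

/-- The Euclidean plane `ℝ²`. -/
abbrev Plane : Type := EuclideanSpace ℝ (Fin 2)

/-- `E` can be covered by `N` axis-parallel boxes `∏ i, [a i, b i]` all of whose side lengths
are at most `ε`. -/
def CoveredByBoxes {n : ℕ} (E : Set (EuclideanSpace ℝ (Fin n))) (ε : ℝ) (N : ℕ) : Prop :=
  ∃ a b : Fin N → Fin n → ℝ,
    (∀ j i, a j i ≤ b j i ∧ b j i - a j i ≤ ε) ∧
      ∀ x ∈ E, ∃ j, ∀ i, x i ∈ Set.Icc (a j i) (b j i)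

/-- The smallest positive number of boxes of side length at most `ε` that cover `E`
(`⊤` if no finite number suffices). -/
noncomputable def boxCoveringNumber {n : ℕ} (E : Set (EuclideanSpace ℝ (Fin n))) (ε : ℝ) : ℕ∞ :=
  ⨅ (N : ℕ) (_ : 0 < N ∧ CoveredByBoxes E ε N), (N : ℕ∞)

/-- The Minkowski (upper box) dimension
`limsup_{ε → 0⁺} log N_E(ε) / log (1 / ε)`, as an extended real number. -/
noncomputable def minkowskiDim {n : ℕ} (E : Set (EuclideanSpace ℝ (Fin n))) : EReal :=
  limsup (fun ε : ℝ =>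
    ENNReal.log (boxCoveringNumber E ε : ENNReal) / ((Real.log (1 / ε) : ℝ) : EReal)) (𝓝[>] 0)

/-- `V` is the vertex set of a convex `k`-gon: `k ≥ 3` points in convex position. -/
def IsConvexPolygonVertexSet (k : ℕ) (V : Finset Plane) : Prop :=
  3 ≤ k ∧ V.card = k ∧ ConvexIndependent ℝ (fun v : V => (v : Plane))

/-- The convex polygon with vertex set `V`, as a closed curve. -/
def polygon (V : Finset Plane) : Set Plane :=
  frontier (convexHull ℝ (V : Set Plane))

/-- All points of `V` lie in the square lattice `m⁻¹ ℤ²` for some positive integer `m`. -/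
def IsLatticeSet (V : Finset Plane) : Prop :=
  ∃ m : ℕ, 0 < m ∧ ∀ v ∈ V, ∀ i, ∃ z : ℤ, v i = (z : ℝ) / (m : ℝ)

/-- Counterclockwise rotation of the plane about the origin by the angle `θ`. -/
noncomputable def rotate (θ : ℝ) (v : Plane) : Plane :=
  !₂[Real.cos θ * v 0 - Real.sin θ * v 1, Real.sin θ * v 0 + Real.cos θ * v 1]

/-- `B` contains a copy of `V`, scaled by some `s > 0` and rotated, with the origin
moved to `x`. -/
def ContainsCopyCenteredAt (B : Set Plane) (V : Finset Plane) (x : Plane) : Prop :=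
  ∃ s θ : ℝ, 0 < s ∧ ∀ v ∈ V, x + s • rotate θ v ∈ B

/-!
For `N ≍ k²`, let `B` be the set of points of a fixed square whose coordinates lie within `N⁻ⁿ / 4`
of `N⁻ⁿ ℤ` for every `n`. Passing from one scale to the next keeps at most `3 N / 4` of the `N`
subintervals in each coordinate, so `B` has dimension at most `2 - 2 log (4 / 3) / log N`.

Identify the plane with `ℂ`. Given `x`, choose the real numbers `ω` and `w` greedily, scale by
scale, so that each is extremely close to `(4 Nⁿ)⁻¹ ℤ` for every `n` while `x + ω + i w` has
coordinates close to `N⁻ⁿ ℤ`. Multiplying `ω + i w` by a Gaussian integer `≡ 1` modulo `4`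
changes `x + ω + i w` only by nearly a vector of `N⁻ⁿ ℤ²`. Hence `x + m (ω + i w) v` lies in `B`
simultaneously for all `v ∈ m⁻¹ ℤ²` of bounded size with numerator `m v ≡ 1` modulo `4`.

It remains to round the regular `k`-gon to such points with `m = 4 k²`. In the direction of a
vertex, that vertex exceeds every other one by at least `8 / k²`, so errors of `1 / k²` preserve
convex position.
-/

section PolarCoordinates

/-- The point of the unit circle at angle `θ`. -/
noncomputable def circlePoint (θ : ℝ) : Plane :=
  !₂[Real.cos θ, Real.sin θ]

theorem norm_circlePoint (θ : ℝ) : ‖circlePoint θ‖ = 1 := by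
  simp [EuclideanSpace.norm_eq, circlePoint]

theorem inner_circlePoint (φ θ : ℝ) :
    inner ℝ (circlePoint φ) (circlePoint θ) = Real.cos (θ - φ) := by
  simp [PiLp.inner_apply, circlePoint, Real.cos_sub]

theorem exists_norm_smul_circlePoint_eq (v : Plane) : ∃ φ, ‖v‖ • circlePoint φ = v := by
  let ζ : ℂ := ⟨v 0, v 1⟩
  have hnorm : ‖v‖ = ‖ζ‖ := by
    rw [EuclideanSpace.norm_eq, Complex.norm_eq_sqrt_sq_add_sq, Fin.sum_univ_two]
    simp [ζ]
  refine ⟨ζ.arg, ?_⟩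
  rw [hnorm]
  ext i
  fin_cases i
  · exact Complex.norm_mul_cos_arg ζ
  · exact Complex.norm_mul_sin_arg ζ

theorem exists_smul_rotate_eq {u : Plane} (hu : u ≠ 0) :
    ∃ s θ : ℝ, 0 < s ∧
      ∀ v, s • rotate θ v = !₂[u 0 * v 0 - u 1 * v 1, u 1 * v 0 + u 0 * v 1] := by
  obtain ⟨θ, hθ⟩ := exists_norm_smul_circlePoint_eq u
  refine ⟨‖u‖, θ, norm_pos_iff.2 hu, fun v => ?_⟩
  have h0 : u 0 = ‖u‖ * Real.cos θ := (congrArg (fun y : Plane => y 0) hθ).symm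
  have h1 : u 1 = ‖u‖ * Real.sin θ := (congrArg (fun y : Plane => y 1) hθ).symm
  ext i
  fin_cases i
  · change ‖u‖ * (Real.cos θ * v 0 - Real.sin θ * v 1) = u 0 * v 0 - u 1 * v 1
    rw [h0, h1]
    ring
  · change ‖u‖ * (Real.sin θ * v 0 + Real.cos θ * v 1) = u 1 * v 0 + u 0 * v 1
    rw [h0, h1]
    ring

end PolarCoordinates

section MinkowskiDimension

variable {d : ℕ} {E : Set (EuclideanSpace ℝ (Fin d))}

theorem boxCoveringNumber_le_of_coveredByBoxes {ε : ℝ} {M : ℕ} (hM : 0 < M)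
    (h : CoveredByBoxes E ε M) : boxCoveringNumber E ε ≤ M :=
  iInf₂_le M ⟨hM, h⟩

theorem CoveredByBoxes.mono {δ ε : ℝ} {M : ℕ} (h : CoveredByBoxes E δ M) (hδε : δ ≤ ε) :
    CoveredByBoxes E ε M := by
  obtain ⟨a, b, hab, hE⟩ := h
  exact ⟨a, b, fun j i => ⟨(hab j i).1, (hab j i).2.trans hδε⟩, hE⟩

theorem boxCoveringNumber_antitone : Antitone (boxCoveringNumber E) := fun _ _ hδε =>
  le_iInf₂ fun _ hM => boxCoveringNumber_le_of_coveredByBoxes hM.1 (hM.2.mono hδε)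

theorem boxCoveringNumber_le_card_pow {C : Finset ℝ} (hC : C.Nonempty) {ε : ℝ} (hε : 0 ≤ ε)
    (h : ∀ y ∈ E, ∀ i, ∃ c ∈ C, |y i - c| ≤ ε / 2) :
    boxCoveringNumber E ε ≤ (C.card ^ d : ℕ) := by
  have hcard : Fintype.card (Fin d → C) = C.card ^ d := by simp
  let centre : Fin (C.card ^ d) ≃ (Fin d → C) := (Fintype.equivFinOfCardEq hcard).symm
  refine boxCoveringNumber_le_of_coveredByBoxes (pow_pos (Finset.card_pos.2 hC) d)
    ⟨fun j i => centre j i - ε / 2, fun j i => centre j i + ε / 2,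
      fun j i => ⟨by linarith, by linarith⟩, fun y hy => ?_⟩
  choose c hcC hc using h y hy
  refine ⟨centre.symm fun i => ⟨c i, hcC i⟩, fun i => ?_⟩
  simpa only [Equiv.apply_symm_apply, Set.mem_Icc_iff_abs_le, abs_sub_comm] using hc i

theorem tendsto_log_one_div_nhdsGT_zero :
    Tendsto (fun ε : ℝ => Real.log (1 / ε)) (𝓝[>] 0) atTop := by
  simp only [one_div]
  exact Real.tendsto_log_atTop.comp tendsto_inv_nhdsGT_zero

theorem minkowskiDim_le_of_boxCoveringNumber_le_rpow {C s : ℝ} (hC : 0 < C)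
    (h : ∀ᶠ ε in 𝓝[>] 0,
      (boxCoveringNumber E ε : ENNReal) ≤ ENNReal.ofReal (C * (1 / ε) ^ s)) :
    minkowskiDim E ≤ (s : EReal) := by
  have hlim : Tendsto (fun ε : ℝ => Real.log C / Real.log (1 / ε) + s) (𝓝[>] 0) (𝓝 s) := by
    simpa using (tendsto_log_one_div_nhdsGT_zero.const_div_atTop (Real.log C)).add_const s
  have hlim' := (continuous_coe_real_ereal.tendsto _).comp hlim
  rw [← hlim'.limsup_eq]
  refine limsup_le_limsup ?_
  filter_upwards [h, tendsto_log_one_div_nhdsGT_zero.eventually_gt_atTop 0,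
    self_mem_nhdsWithin] with ε hcover hlog (hε : 0 < ε)
  have hlogcover := ENNReal.log_le_log hcover
  rw [ENNReal.log_ofReal_of_pos (by positivity), Real.log_mul hC.ne' (by positivity),
    Real.log_rpow (by positivity)] at hlogcover
  calc ENNReal.log (boxCoveringNumber E ε) / (Real.log (1 / ε) : EReal)
      ≤ ((Real.log C + s * Real.log (1 / ε) : ℝ) : EReal) / (Real.log (1 / ε) : EReal) :=
        EReal.div_le_div_right_of_nonneg (by exact_mod_cast hlog.le) hlogcover
    _ = ((Real.log C / Real.log (1 / ε) + s : ℝ) : EReal) := by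
        rw [← EReal.coe_div, add_div, mul_div_cancel_right₀ _ hlog.ne']

theorem minkowskiDim_le_logb_of_geometric {N K L : ℝ} (hN : 1 < N) (hK : 0 < K) (hL : 1 ≤ L)
    (h : ∀ n : ℕ, (boxCoveringNumber E (1 / N ^ n) : ENNReal) ≤ ENNReal.ofReal (K * L ^ n)) :
    minkowskiDim E ≤ (Real.logb N L : EReal) := by
  have hN₀ : 0 < N := by linarith
  have hs : 0 ≤ Real.logb N L := Real.logb_nonneg hN hL
  have hNs : N ^ Real.logb N L = L := Real.rpow_logb hN₀ hN.ne' (by linarith)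
  refine minkowskiDim_le_of_boxCoveringNumber_le_rpow (C := K * L) (by positivity) ?_
  filter_upwards [Ioo_mem_nhdsGT (zero_lt_one' ℝ)] with ε ⟨hε, hε1⟩
  obtain ⟨n, hn, hn'⟩ := exists_nat_pow_near (one_le_one_div hε hε1.le) hN
  have hLn : L ^ n ≤ (1 / ε) ^ Real.logb N L := by
    calc L ^ n = (N ^ n) ^ Real.logb N L := by
          rw [← Real.rpow_pow_comm hN₀.le, hNs]
      _ ≤ (1 / ε) ^ Real.logb N L := by gcongr
  calc (boxCoveringNumber E ε : ENNReal)
      ≤ boxCoveringNumber E (1 / N ^ (n + 1)) := by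
        gcongr
        exact boxCoveringNumber_antitone ((one_div_le (by positivity) hε).2 hn'.le)
    _ ≤ ENNReal.ofReal (K * L ^ (n + 1)) := h (n + 1)
    _ ≤ ENNReal.ofReal (K * L * (1 / ε) ^ Real.logb N L) := by
        rw [pow_succ', ← mul_assoc]
        gcongr

end MinkowskiDimension

section NearGrid

/-- The compact Cantor-like set of the reals in `[-N, N]` that lie within `N⁻ⁿ / 4` of the grid
`N⁻ⁿ ℤ` for every `n`. The condition at scale `n` is multiplied by `N ^ n`. -/
def nearGrid (N : ℝ) : Set ℝ :=
  {t | |t| ≤ N ∧ ∀ n : ℕ, ∃ z : ℤ, |N ^ n * t - z| ≤ 1 / 4}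

/-- The `d`-fold product of `nearGrid N`; for `d = 2` this is the small set that contains the
copies of a polygon. -/
def nearGridCube (d : ℕ) (N : ℝ) : Set (EuclideanSpace ℝ (Fin d)) :=
  {y | ∀ i, y i ∈ nearGrid N}

theorem isBounded_nearGridCube (d : ℕ) (N : ℝ) : Bornology.IsBounded (nearGridCube d N) := by
  have hN : Bornology.IsBounded (nearGrid N) :=
    (Metric.isBounded_Icc (-N) N).subset fun t ht => abs_le.1 ht.1
  have hpi : Bornology.IsBounded (Set.univ.pi fun _ : Fin d => nearGrid N) :=
    Bornology.IsBounded.pi fun _ => hN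
  exact ((PiLp.antilipschitzWith_ofLp 2 _).isBounded_preimage hpi).subset fun _ hy i _ => hy i

theorem zero_mem_nearGrid {N : ℝ} (hN : 0 ≤ N) : (0 : ℝ) ∈ nearGrid N :=
  ⟨by simpa using hN, fun n => ⟨0, by norm_num⟩⟩

/-- The integers at distance at most `r` from `x`, as a finite set to be counted. -/
noncomputable def integersNear (x r : ℝ) : Finset ℤ :=
  Finset.Icc ⌈x - r⌉ ⌊x + r⌋

theorem mem_integersNear {x r : ℝ} {z : ℤ} : z ∈ integersNear x r ↔ |x - z| ≤ r := by
  rw [integersNear, Finset.mem_Icc, Int.ceil_le, Int.le_floor, abs_sub_le_iff]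
  constructor <;> rintro ⟨h₁, h₂⟩ <;> constructor <;> linarith

theorem card_integersNear_le (x : ℝ) {r : ℝ} (hr : 0 ≤ r) :
    ((integersNear x r).card : ℝ) ≤ 2 * r + 1 := by
  rw [integersNear, Int.card_Icc]
  have hceil := Int.le_ceil (x - r)
  have hfloor := Int.floor_le (x + r)
  rcases le_total 0 (⌊x + r⌋ + 1 - ⌈x - r⌉) with h | h
  · rw [← Int.cast_natCast, Int.toNat_of_nonneg h]
    push_cast
    linarith
  · rw [Int.toNat_of_nonpos h, Nat.cast_zero]
    linarith

/-- A finite set containing every integer `z` within `1 / 4` of some `N ^ n * t` with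
`t ∈ nearGrid N`, built scale by scale: a candidate `z` at scale `n` has as descendants the
integers near `N * z`. -/
noncomputable def gridCandidates (N : ℝ) : ℕ → Finset ℤ
  | 0 => integersNear 0 (N + 1 / 4)
  | n + 1 => (gridCandidates N n).biUnion fun z => integersNear (N * z) (N / 4 + 1 / 4)

theorem card_gridCandidates_le {N : ℝ} (hN : 6 ≤ N) (n : ℕ) :
    ((gridCandidates N n).card : ℝ) ≤ 3 * N * (3 / 4 * N) ^ n := by
  induction n with
  | zero =>
    refine (card_integersNear_le 0 (by linarith)).trans ?_
    rw [pow_zero]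
    linarith
  | succ n ih =>
    calc ((gridCandidates N (n + 1)).card : ℝ)
        ≤ ∑ z ∈ gridCandidates N n, ((integersNear (N * z) (N / 4 + 1 / 4)).card : ℝ) := by
          exact_mod_cast Finset.card_biUnion_le
      _ ≤ (gridCandidates N n).card * (3 / 4 * N) := by
          rw [← nsmul_eq_mul]
          refine Finset.sum_le_card_nsmul _ _ _ fun z _ => ?_
          refine (card_integersNear_le _ (by linarith)).trans ?_
          linarith
      _ ≤ 3 * N * (3 / 4 * N) ^ n * (3 / 4 * N) := by gcongr
      _ = 3 * N * (3 / 4 * N) ^ (n + 1) := by ring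

theorem mem_gridCandidates {N : ℝ} (hN : 0 ≤ N) {t : ℝ} (ht : t ∈ nearGrid N) {n : ℕ} {z : ℤ}
    (hz : |N ^ n * t - z| ≤ 1 / 4) : z ∈ gridCandidates N n := by
  induction n generalizing z with
  | zero =>
    refine mem_integersNear.2 ?_
    rw [pow_zero, one_mul] at hz
    rw [zero_sub, abs_neg]
    linarith [abs_sub_abs_le_abs_sub (z : ℝ) t, abs_sub_comm (z : ℝ) t, ht.1]
  | succ n ih =>
    obtain ⟨w, hw⟩ := ht.2 n
    refine Finset.mem_biUnion.2 ⟨w, ih hw, mem_integersNear.2 ?_⟩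
    calc |N * w - z| ≤ |N * w - N ^ (n + 1) * t| + |N ^ (n + 1) * t - z| := abs_sub_le _ _ _
      _ = N * |N ^ n * t - w| + |N ^ (n + 1) * t - z| := by
          rw [abs_sub_comm, pow_succ', mul_assoc, ← mul_sub, abs_mul, abs_of_nonneg hN]
      _ ≤ N * (1 / 4) + 1 / 4 := by gcongr
      _ = N / 4 + 1 / 4 := by ring

theorem boxCoveringNumber_nearGridCube_le (d : ℕ) {N : ℝ} (hN : 6 ≤ N) (n : ℕ) :
    (boxCoveringNumber (nearGridCube d N) (1 / N ^ n) : ENNReal) ≤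
      ENNReal.ofReal ((3 * N) ^ d * ((3 / 4 * N) ^ d) ^ n) := by
  have hN₀ : 0 < N := by linarith
  let C : Finset ℝ := (gridCandidates N n).image fun z : ℤ => (z : ℝ) / N ^ n
  have hnear : ∀ t ∈ nearGrid N, ∃ c ∈ C, |t - c| ≤ 1 / N ^ n / 2 := fun t ht => by
    obtain ⟨z, hz⟩ := ht.2 n
    refine ⟨z / N ^ n, Finset.mem_image_of_mem _ (mem_gridCandidates hN₀.le ht hz), ?_⟩
    calc |t - z / N ^ n| = |N ^ n * t - z| / N ^ n := by
          rw [← abs_of_pos (pow_pos hN₀ n), ← abs_div, abs_of_pos (pow_pos hN₀ n)]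
          congr 1
          field_simp
      _ ≤ 1 / 2 / N ^ n := by
          gcongr
          linarith
      _ = 1 / N ^ n / 2 := div_right_comm _ _ _
  obtain ⟨c₀, hc₀, -⟩ := hnear 0 (zero_mem_nearGrid hN₀.le)
  have hcover : boxCoveringNumber (nearGridCube d N) (1 / N ^ n) ≤ (C.card ^ d : ℕ) :=
    boxCoveringNumber_le_card_pow ⟨c₀, hc₀⟩ (by positivity) fun y hy i => hnear (y i) (hy i)
  have hcard : (C.card : ℝ) ≤ 3 * N * (3 / 4 * N) ^ n :=
    (Nat.cast_le.2 Finset.card_image_le).trans (card_gridCandidates_le hN n)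
  calc (boxCoveringNumber (nearGridCube d N) (1 / N ^ n) : ENNReal)
      ≤ ((C.card ^ d : ℕ) : ENNReal) := by exact_mod_cast hcover
    _ = ENNReal.ofReal ((C.card : ℝ) ^ d) := by
        rw [← ENNReal.ofReal_natCast, Nat.cast_pow]
    _ ≤ ENNReal.ofReal ((3 * N) ^ d * ((3 / 4 * N) ^ d) ^ n) := by
        rw [pow_right_comm, ← mul_pow]
        gcongr

theorem minkowskiDim_nearGridCube_le (d : ℕ) {N : ℝ} (hN : 6 ≤ N) :
    minkowskiDim (nearGridCube d N) ≤ ((d - d * Real.log (4 / 3) / Real.log N : ℝ) : EReal) := by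
  have hlogN : Real.log N ≠ 0 := (Real.log_pos (by linarith)).ne'
  have hL : 1 ≤ (3 / 4 * N) ^ d := one_le_pow₀ (by linarith)
  have hlogb : Real.logb N ((3 / 4 * N) ^ d) = d - d * Real.log (4 / 3) / Real.log N := by
    rw [Real.logb, Real.log_pow, Real.log_mul (by norm_num) (by linarith),
      show (3 / 4 : ℝ) = (4 / 3)⁻¹ by norm_num, Real.log_inv]
    field_simp
    ring
  rw [← hlogb]
  exact minkowskiDim_le_logb_of_geometric (by linarith) (by positivity) hL
    (boxCoveringNumber_nearGridCube_le d hN)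

end NearGrid

section CenteredCopies

/-- `ω` is a step length adapted to the coordinate `ξ`: at every scale, `ω` is very close to a
point `p` of `(4 Nⁿ)⁻¹ ℤ` with `ξ + p` close to `N⁻ⁿ ℤ`. Both conditions are multiplied
by `N ^ n`. -/
def IsAdapted (N ξ ω : ℝ) : Prop :=
  ∀ n : ℕ, ∃ c z : ℤ, |N ^ n * ω - c / 4| ≤ 2 / N ∧ |N ^ n * ξ + c / 4 - z| ≤ 1 / 8

theorem exists_quarter_int_near (a b : ℝ) :
    ∃ c z : ℤ, |b - c / 4| ≤ 1 ∧ |a + c / 4 - z| ≤ 1 / 8 := by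
  let z : ℤ := round (a + b)
  let c : ℤ := round (4 * (z - a))
  have hz : |a + b - z| ≤ 1 / 2 := abs_sub_round _
  have hc : |4 * (z - a) - c| ≤ 1 / 2 := abs_sub_round _
  rw [abs_le] at hz hc
  refine ⟨c, z, ?_, ?_⟩ <;> rw [abs_le] <;> constructor <;> linarith

theorem exists_forall_abs_sub_le_of_geometric {N : ℝ} (hN : 2 ≤ N) {u : ℕ → ℝ}
    (hu : ∀ n, |u n - u (n + 1)| ≤ 1 / N ^ n) : ∃ ω, ∀ n, |ω - u n| ≤ 2 / N ^ n := by
  have hratio : N⁻¹ ≤ 1 / 2 := by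
    rw [inv_le_comm₀ (by linarith) (by norm_num)]
    linarith
  have hdist : ∀ n, dist (u n) (u (n + 1)) ≤ 1 * N⁻¹ ^ n := fun n => by
    rw [one_mul, inv_pow, ← one_div]
    exact hu n
  obtain ⟨ω, hω⟩ := cauchySeq_tendsto_of_complete
    (cauchySeq_of_le_geometric _ _ (by linarith) hdist)
  refine ⟨ω, fun n => ?_⟩
  calc |ω - u n| = dist (u n) ω := abs_sub_comm _ _
    _ ≤ 1 * N⁻¹ ^ n / (1 - N⁻¹) := dist_le_of_le_geometric_of_tendsto _ _ (by linarith) hdist hω n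
    _ ≤ 1 * N⁻¹ ^ n / (1 / 2) := by
        gcongr
        linarith
    _ = 2 / N ^ n := by
        rw [inv_pow]
        ring

theorem exists_isAdapted {N : ℝ} (hN : 2 ≤ N) (ξ ω₀ : ℝ) :
    ∃ ω, |ω - ω₀| ≤ 2 ∧ IsAdapted N ξ ω := by
  have hN₀ : 0 < N := by linarith
  choose c z hc hz using exists_quarter_int_near
  let u : ℕ → ℝ := fun n =>
    Nat.rec ω₀ (fun n w => c (N ^ n * ξ) (N ^ n * w) / 4 / N ^ n) n
  have hu (n : ℕ) : N ^ n * u (n + 1) = c (N ^ n * ξ) (N ^ n * u n) / 4 :=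
    mul_div_cancel₀ _ (pow_pos hN₀ n).ne'
  have hstep (n : ℕ) : |u n - u (n + 1)| ≤ 1 / N ^ n := by
    rw [le_div_iff₀' (pow_pos hN₀ n)]
    calc N ^ n * |u n - u (n + 1)| = |N ^ n * u n - c (N ^ n * ξ) (N ^ n * u n) / 4| := by
          rw [← hu, ← mul_sub, abs_mul, abs_of_pos (pow_pos hN₀ n)]
      _ ≤ 1 := hc _ _
  obtain ⟨ω, hω⟩ := exists_forall_abs_sub_le_of_geometric hN hstep
  refine ⟨ω, by simpa [u] using hω 0, fun n =>
    ⟨c (N ^ n * ξ) (N ^ n * u n), z (N ^ n * ξ) (N ^ n * u n), ?_, hz _ _⟩⟩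
  calc |N ^ n * ω - c (N ^ n * ξ) (N ^ n * u n) / 4| = N ^ n * |ω - u (n + 1)| := by
        rw [← hu, ← mul_sub, abs_mul, abs_of_pos (pow_pos hN₀ n)]
    _ ≤ N ^ n * (2 / N ^ (n + 1)) := by
        gcongr
        exact hω (n + 1)
    _ = 2 / N := by
        rw [pow_succ]
        field_simp

/- For `a = 1 + 4 a'` and `b = 4 b'`, the products `(c / 4) * a` and `(c' / 4) * b` differ from
`c / 4` and `0` by integers, so `ξ + ω * a + w * b` inherits the approximation of `ξ + ω`. -/
theorem add_mul_add_mul_mem_nearGrid {N A ξ η ω w : ℝ} (hN : 2 ≤ N) (hA : 32 * A ≤ N)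
    (hξ : |ξ| ≤ 1) (hω : IsAdapted N ξ ω) (hw : IsAdapted N η w) (hω5 : |ω| ≤ 5) (hw5 : |w| ≤ 5)
    {a b : ℤ} (ha : a ≡ 1 [ZMOD 4]) (hb : b ≡ 0 [ZMOD 4]) (haA : |(a : ℝ)| ≤ A)
    (hbA : |(b : ℝ)| ≤ A) : ξ + ω * a + w * b ∈ nearGrid N := by
  have hN₀ : 0 < N := by linarith
  refine ⟨?_, fun n => ?_⟩
  · calc |ξ + ω * a + w * b| ≤ |ξ| + |ω| * |(a : ℝ)| + |w| * |(b : ℝ)| := by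
          rw [← abs_mul, ← abs_mul]
          exact abs_add_three _ _ _
      _ ≤ 1 + 5 * A + 5 * A := by gcongr
      _ ≤ N := by linarith
  · obtain ⟨a', ha'⟩ := ha.symm.dvd
    obtain ⟨b', hb'⟩ := hb.symm.dvd
    obtain rfl : a = 1 + 4 * a' := by linarith
    obtain rfl : b = 4 * b' := by linarith
    obtain ⟨c, z, hc, hz⟩ := hω n
    obtain ⟨c', -, hc', -⟩ := hw n
    have herror {δ s : ℝ} (hδ : |δ| ≤ 2 / N) (hs : |s| ≤ A) : |δ * s| ≤ 1 / 16 := by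
      calc |δ * s| ≤ 2 / N * A := by
            rw [abs_mul]
            gcongr
        _ ≤ 1 / 16 := by
            rw [div_mul_eq_mul_div, div_le_iff₀ hN₀]
            linarith
    refine ⟨z + c * a' + c' * b', ?_⟩
    push_cast at haA hbA ⊢
    calc |N ^ n * (ξ + ω * (1 + 4 * a') + w * (4 * b')) - (z + c * a' + c' * b')|
        = |(N ^ n * ξ + c / 4 - z) + (N ^ n * ω - c / 4) * (1 + 4 * a')
            + (N ^ n * w - c' / 4) * (4 * b')| := by
          congr 1
          ring
      _ ≤ 1 / 8 + 1 / 16 + 1 / 16 :=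
          (abs_add_three _ _ _).trans (add_le_add_three hz (herror hc haA) (herror hc' hbA))
      _ = 1 / 4 := by norm_num

/-- `v` is a point of `m⁻¹ ℤ²` whose numerators are congruent to `(1, 0)` modulo `4`: the
congruence that makes the copies of `v` land in `nearGridCube`. -/
def IsAligned (m : ℕ) (v : Plane) : Prop :=
  ∃ a b : ℤ, a ≡ 1 [ZMOD 4] ∧ b ≡ 0 [ZMOD 4] ∧ v 0 = a / m ∧ v 1 = b / m

theorem isLatticeSet_of_isAligned {m : ℕ} (hm : 0 < m) {V : Finset Plane}
    (hV : ∀ v ∈ V, IsAligned m v) : IsLatticeSet V := by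
  refine ⟨m, hm, fun v hv => ?_⟩
  obtain ⟨a, b, -, -, h0, h1⟩ := hV v hv
  exact Fin.forall_fin_two.2 ⟨⟨a, h0⟩, ⟨b, h1⟩⟩

theorem containsCopyCenteredAt_nearGridCube {N r : ℝ} {m : ℕ} (hm : 0 < m) (hN : 2 ≤ N)
    (hr : 32 * (m * r) ≤ N) {V : Finset Plane} (hV : ∀ v ∈ V, IsAligned m v ∧ ‖v‖ ≤ r)
    {x : Plane} (hx : ∀ i, |x i| ≤ 1) : ContainsCopyCenteredAt (nearGridCube 2 N) V x := by
  have hm₀ : (0 : ℝ) < m := Nat.cast_pos.2 hm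
  -- Centring the search at `3` keeps `ω` away from `0`, hence the scaling factor positive.
  obtain ⟨ω, hω3, hω⟩ := exists_isAdapted hN (x 0) 3
  obtain ⟨w, hw3, hw⟩ := exists_isAdapted hN (x 1) 3
  rw [abs_le] at hω3 hw3
  have hω5 : |ω| ≤ 5 := abs_le.2 ⟨by linarith, by linarith⟩
  have hw5 : |w| ≤ 5 := abs_le.2 ⟨by linarith, by linarith⟩
  have hu : !₂[m * ω, m * w] ≠ (0 : Plane) := fun h =>
    (mul_pos hm₀ (by linarith : 0 < ω)).ne' (congrArg (fun u : Plane => u 0) h)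
  obtain ⟨s, θ, hs, hrotate⟩ := exists_smul_rotate_eq hu
  refine ⟨s, θ, hs, fun v hv => ?_⟩
  obtain ⟨⟨a, b, ha, hb, h0, h1⟩, hvr⟩ := hV v hv
  have hnumerator {i : Fin 2} {e : ℤ} (h : v i = e / m) : |(e : ℝ)| ≤ m * r := by
    calc |(e : ℝ)| = m * |v i| := by
          rw [h, abs_div, abs_of_pos hm₀, mul_div_cancel₀ _ hm₀.ne']
      _ ≤ m * r := by
          gcongr
          exact (PiLp.norm_apply_le v i).trans hvr
  have hcopy : x + s • rotate θ v = !₂[x 0 + ω * a + w * (-b : ℤ), x 1 + w * a + ω * b] := by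
    rw [hrotate, h0, h1]
    ext i
    fin_cases i
    · change x 0 + (m * ω * (a / m) - m * w * (b / m)) = x 0 + ω * a + w * (-b : ℤ)
      push_cast
      field_simp
      ring
    · change x 1 + (m * w * (a / m) + m * ω * (b / m)) = x 1 + w * a + ω * b
      field_simp
      ring
  rw [hcopy]
  exact Fin.forall_fin_two.2
    ⟨add_mul_add_mul_mem_nearGrid hN hr (hx 0) hω hw hω5 hw5 ha hb.neg (hnumerator h0)
      (by simpa using hnumerator h1),
    add_mul_add_mul_mem_nearGrid hN hr (hx 1) hw hω hw5 hω5 ha hb (hnumerator h0)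
      (hnumerator h1)⟩

end CenteredCopies

section ConvexGeometry

theorem convexIndependent_of_forall_exists_lt {ι F : Type*} [AddCommGroup F] [Module ℝ F]
    {p : ι → F} (h : ∀ i, ∃ f : F →ₗ[ℝ] ℝ, ∀ j ≠ i, f (p j) < f (p i)) :
    ConvexIndependent ℝ p := by
  refine convexIndependent_iff_notMem_convexHull_sdiff.2 fun i s hi => ?_
  obtain ⟨f, hf⟩ := h i
  have hsub : p '' (s \ {i}) ⊆ {v | f v < f (p i)} := by
    rintro _ ⟨j, hj, rfl⟩
    exact hf j hj.2
  exact lt_irrefl (f (p i)) (convexHull_min hsub (convex_halfSpace_lt f.isLinear _) hi)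

theorem closedBall_subset_of_forall_exists_le_inner {F : Type*} [NormedAddCommGroup F]
    [InnerProductSpace ℝ F] [CompleteSpace F] {K : Set F} (hconv : Convex ℝ K)
    (hclosed : IsClosed K) {a : ℝ} (h : ∀ u : F, ∃ v ∈ K, a * ‖u‖ ≤ inner ℝ u v) :
    Metric.closedBall 0 a ⊆ K := by
  intro x hx
  by_contra hxK
  obtain ⟨f, c, hfK, hfx⟩ := geometric_hahn_banach_closed_point hconv hclosed hxK
  obtain ⟨u, rfl⟩ := (InnerProductSpace.toDual ℝ F).surjective f
  obtain ⟨v, hv, hav⟩ := h u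
  have hlt : inner ℝ u v < inner ℝ u x := (hfK v hv).trans hfx
  have hle : inner ℝ u x ≤ a * ‖u‖ := by
    calc inner ℝ u x ≤ ‖u‖ * ‖x‖ := real_inner_le_norm u x
      _ ≤ a * ‖u‖ := by
        rw [mul_comm]
        gcongr
        exact mem_closedBall_zero_iff.1 hx
  linarith

variable {F : Type*} [NormedAddCommGroup F] {K : Set F} {r : ℝ}

theorem abs_norm_sub_one_le_of_mem_frontier (hin : Metric.closedBall 0 (1 - r) ⊆ K)
    (hout : K ⊆ Metric.closedBall 0 (1 + r)) {y : F} (hy : y ∈ frontier K) : |‖y‖ - 1| ≤ r := by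
  have hupper : ‖y‖ ≤ 1 + r :=
    mem_closedBall_zero_iff.1 (closure_minimal hout Metric.isClosed_closedBall hy.1)
  have hlower : 1 - r ≤ ‖y‖ := by
    by_contra! hlt
    exact hy.2 (interior_mono hin
      (Metric.ball_subset_interior_closedBall (mem_ball_zero_iff.2 hlt)))
  rw [abs_le]
  constructor <;> linarith

variable [NormedSpace ℝ F]

theorem exists_nonneg_smul_mem_frontier {x : F} (h0 : (0 : F) ∈ K) {t : ℝ} (ht : 0 ≤ t)
    (htx : t • x ∉ K) : ∃ s : ℝ, 0 ≤ s ∧ s • x ∈ frontier K := by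
  have hcont : Continuous fun s : ℝ => |s| • x := by fun_prop
  obtain ⟨s, hs⟩ : (frontier ((fun s : ℝ => |s| • x) ⁻¹' K)).Nonempty := by
    refine nonempty_frontier_iff.2 ⟨⟨0, by simpa using h0⟩, fun huniv => htx ?_⟩
    have htK : t ∈ (fun s : ℝ => |s| • x) ⁻¹' K := huniv ▸ Set.mem_univ t
    rwa [Set.mem_preimage, abs_of_nonneg ht] at htK
  exact ⟨|s|, abs_nonneg s, hcont.frontier_preimage_subset K hs⟩

theorem dist_smul_self_of_norm_eq_one {x : F} (hx : ‖x‖ = 1) (t : ℝ) :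
    dist (t • x) x = |t - 1| := by
  calc dist (t • x) x = ‖(t - 1) • x‖ := by rw [dist_eq_norm, sub_smul, one_smul]
    _ = |t - 1| := by rw [norm_smul, hx, mul_one, Real.norm_eq_abs]

theorem hausdorffEDist_frontier_sphere_le (hr : r < 1) (hin : Metric.closedBall 0 (1 - r) ⊆ K)
    (hout : K ⊆ Metric.closedBall 0 (1 + r)) :
    Metric.hausdorffEDist (frontier K) (Metric.sphere 0 1) ≤ ENNReal.ofReal r := by
  refine Metric.hausdorffEDist_le_of_mem_edist (fun y hy => ?_) fun x hx => ?_
  · have hnorm := abs_norm_sub_one_le_of_mem_frontier hin hout hy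
    have hpos : 0 < ‖y‖ := by linarith [(abs_le.1 hnorm).1]
    have hunit : ‖‖y‖⁻¹ • y‖ = 1 := norm_smul_inv_norm (𝕜 := ℝ) (norm_pos_iff.1 hpos)
    refine ⟨‖y‖⁻¹ • y, mem_sphere_zero_iff_norm.2 hunit, ?_⟩
    rw [edist_dist]
    refine ENNReal.ofReal_le_ofReal ?_
    calc dist y (‖y‖⁻¹ • y) = dist (‖y‖ • ‖y‖⁻¹ • y) (‖y‖⁻¹ • y) := by
          rw [smul_inv_smul₀ hpos.ne']
      _ = |‖y‖ - 1| := dist_smul_self_of_norm_eq_one hunit _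
      _ ≤ r := hnorm
  · rw [mem_sphere_zero_iff_norm] at hx
    have h0 : (0 : F) ∈ K := hin (Metric.mem_closedBall_self (by linarith))
    have h2 : (2 : ℝ) • x ∉ K := fun h => by
      have := mem_closedBall_zero_iff.1 (hout h)
      rw [norm_smul, hx, Real.norm_ofNat] at this
      linarith
    obtain ⟨t, ht, htK⟩ := exists_nonneg_smul_mem_frontier h0 zero_le_two h2
    refine ⟨t • x, htK, ?_⟩
    rw [edist_comm, edist_dist, dist_smul_self_of_norm_eq_one hx]
    have hnorm := abs_norm_sub_one_le_of_mem_frontier hin hout htK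
    rw [norm_smul, hx, mul_one, Real.norm_of_nonneg ht] at hnorm
    exact ENNReal.ofReal_le_ofReal hnorm

end ConvexGeometry

section PerturbedRegularPolygon

theorem two_mul_abs_sub_round_le_abs_sin (x : ℝ) :
    2 * |x - round x| ≤ |Real.sin (Real.pi * x)| := by
  have hπ := Real.pi_pos
  have hsmall : |Real.pi * (x - round x)| ≤ Real.pi / 2 := by
    rw [abs_mul, abs_of_pos hπ, div_eq_mul_one_div]
    gcongr
    exact abs_sub_round x
  calc 2 * |x - round x| = 2 / Real.pi * |Real.pi * (x - round x)| := by
        rw [abs_mul, abs_of_pos hπ]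
        field_simp
    _ ≤ |Real.sin (Real.pi * (x - round x))| := Real.mul_abs_le_abs_sin hsmall
    _ = |Real.sin (Real.pi * x)| := by
        rw [mul_sub, mul_comm Real.pi (round x : ℝ), Real.sin_sub_int_mul_pi, abs_mul,
          abs_neg_one_zpow, one_mul]

theorem cos_two_pi_mul_div_le {k : ℕ} {d : ℤ} (hd : ¬ (k : ℤ) ∣ d) :
    Real.cos (2 * Real.pi * (d / k)) ≤ 1 - 8 / (k : ℝ) ^ 2 := by
  rcases k.eq_zero_or_pos with rfl | hk
  · simp
  have hk₀ : (0 : ℝ) < k := Nat.cast_pos.2 hk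
  have hround : 1 / (k : ℝ) ≤ |(d / k : ℝ) - round (d / k : ℝ)| := by
    have hne : d - k * round (d / k : ℝ) ≠ 0 := fun h =>
      hd ⟨round (d / k : ℝ), sub_eq_zero.1 h⟩
    have hone : (1 : ℝ) ≤ |d - k * (round (d / k : ℝ) : ℝ)| := by
      exact_mod_cast Int.one_le_abs hne
    calc 1 / (k : ℝ) ≤ |d - k * (round (d / k : ℝ) : ℝ)| / k := by gcongr
      _ = |(d / k : ℝ) - round (d / k : ℝ)| := by
          rw [← abs_of_pos hk₀, ← abs_div, abs_of_pos hk₀, sub_div,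
            mul_div_cancel_left₀ _ hk₀.ne']
  have hsin : 2 / (k : ℝ) ≤ |Real.sin (Real.pi * (d / k))| := by
    refine le_trans ?_ (two_mul_abs_sub_round_le_abs_sin _)
    rw [← mul_one_div]
    gcongr
  have hsq : (2 / (k : ℝ)) ^ 2 ≤ Real.sin (Real.pi * (d / k)) ^ 2 := by
    rw [← sq_abs (Real.sin _)]
    gcongr
  calc Real.cos (2 * Real.pi * (d / k)) = 1 - 2 * Real.sin (Real.pi * (d / k)) ^ 2 := by
        rw [mul_assoc, Real.cos_two_mul, Real.cos_sq']
        ring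
    _ ≤ 1 - 2 * (2 / (k : ℝ)) ^ 2 := by gcongr
    _ = 1 - 8 / (k : ℝ) ^ 2 := by ring

/-- The angle of the `j`-th vertex of the regular `k`-gon inscribed in the unit circle. -/
noncomputable def vertexAngle (k j : ℕ) : ℝ :=
  2 * Real.pi * (j / k)

theorem cos_vertexAngle_sub_le {k i j : ℕ} (hi : i < k) (hj : j < k) (hij : j ≠ i) :
    Real.cos (vertexAngle k j - vertexAngle k i) ≤ 1 - 8 / (k : ℝ) ^ 2 := by
  have hd : ¬ (k : ℤ) ∣ (j - i : ℤ) := fun h =>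
    hij (by have := Int.eq_zero_of_abs_lt_dvd h (abs_lt.2 ⟨by omega, by omega⟩); omega)
  convert cos_two_pi_mul_div_le hd using 2
  rw [vertexAngle, vertexAngle]
  push_cast
  ring

theorem exists_le_cos_vertexAngle_sub {k : ℕ} (hk : 0 < k) (φ : ℝ) :
    ∃ j < k, 1 - 5 / (k : ℝ) ^ 2 ≤ Real.cos (vertexAngle k j - φ) := by
  have hπ := Real.pi_pos
  let t : ℝ := φ * k / (2 * Real.pi)
  let J : ℤ := round t
  have hkz : (k : ℤ) ≠ 0 := by omega
  have hJ : |J - t| ≤ 1 / 2 := abs_sub_comm t J ▸ abs_sub_round t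
  obtain ⟨j, hj⟩ := Int.eq_ofNat_of_zero_le (Int.emod_nonneg J hkz)
  refine ⟨j, by have := Int.emod_lt_of_pos J (by omega : (0 : ℤ) < k); omega, ?_⟩
  have hJj : (J : ℝ) = j + k * (J / k : ℤ) := by
    exact_mod_cast (hj ▸ Int.emod_add_mul_ediv J k).symm
  have hangle : vertexAngle k j - φ
      = 2 * Real.pi / k * (J - t) - (J / k : ℤ) * (2 * Real.pi) := by
    rw [hJj, vertexAngle]
    simp only [t]
    field_simp
    ring
  have hsq : (2 * Real.pi / k * (J - t)) ^ 2 / 2 ≤ 5 / (k : ℝ) ^ 2 := by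
    calc (2 * Real.pi / k * (J - t)) ^ 2 / 2 = 2 * Real.pi ^ 2 * |J - t| ^ 2 / k ^ 2 := by
          rw [sq_abs]
          ring
      _ ≤ 2 * Real.pi ^ 2 * (1 / 2) ^ 2 / k ^ 2 := by gcongr
      _ ≤ 5 / (k : ℝ) ^ 2 := by
          gcongr
          nlinarith [Real.pi_lt_d2]
  rw [hangle, Real.cos_sub_int_mul_two_pi]
  linarith [Real.one_sub_sq_div_two_le_cos (x := 2 * Real.pi / k * (J - t))]

theorem abs_inner_circlePoint_sub_cos_le (y : Plane) (φ θ : ℝ) :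
    |inner ℝ (circlePoint φ) y - Real.cos (θ - φ)| ≤ dist y (circlePoint θ) := by
  rw [← inner_circlePoint, ← inner_sub_right, dist_eq_norm]
  simpa [norm_circlePoint] using abs_real_inner_le_norm (circlePoint φ) (y - circlePoint θ)

variable {k : ℕ} {q : Fin k → Plane} {δ : ℝ}

theorem convexIndependent_of_dist_circlePoint_lt
    (hq : ∀ j, dist (q j) (circlePoint (vertexAngle k j)) < 4 / (k : ℝ) ^ 2) :
    ConvexIndependent ℝ q := by
  refine convexIndependent_of_forall_exists_lt fun i =>
    ⟨(innerSL ℝ (circlePoint (vertexAngle k i))).toLinearMap, fun j hji => ?_⟩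
  change inner ℝ (circlePoint (vertexAngle k i)) (q j) <
    inner ℝ (circlePoint (vertexAngle k i)) (q i)
  have hi := abs_sub_le_iff.1
    (abs_inner_circlePoint_sub_cos_le (q i) (vertexAngle k i) (vertexAngle k i))
  have hj := abs_sub_le_iff.1
    (abs_inner_circlePoint_sub_cos_le (q j) (vertexAngle k i) (vertexAngle k j))
  have hcos := cos_vertexAngle_sub_le i.isLt j.isLt (Fin.val_ne_of_ne hji)
  rw [sub_self, Real.cos_zero] at hi
  have h8 : 8 / (k : ℝ) ^ 2 = 4 / (k : ℝ) ^ 2 + 4 / (k : ℝ) ^ 2 := by ring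
  linarith [hi.2, hj.1, hq i, hq j]

theorem closedBall_subset_convexHull_of_dist_circlePoint_le (hk : 0 < k)
    (hq : ∀ j, dist (q j) (circlePoint (vertexAngle k j)) ≤ δ) :
    Metric.closedBall 0 (1 - (5 / (k : ℝ) ^ 2 + δ)) ⊆ convexHull ℝ (Set.range q) := by
  refine closedBall_subset_of_forall_exists_le_inner (convex_convexHull ℝ _)
    ((Set.finite_range q).isClosed_convexHull ℝ) fun u => ?_
  obtain ⟨φ, hφ⟩ := exists_norm_smul_circlePoint_eq u
  obtain ⟨j, hj, hcos⟩ := exists_le_cos_vertexAngle_sub hk φ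
  refine ⟨q ⟨j, hj⟩, subset_convexHull ℝ _ (Set.mem_range_self _), ?_⟩
  have hinner := abs_sub_le_iff.1
    ((abs_inner_circlePoint_sub_cos_le (q ⟨j, hj⟩) φ (vertexAngle k j)).trans (hq ⟨j, hj⟩))
  calc (1 - (5 / (k : ℝ) ^ 2 + δ)) * ‖u‖
      ≤ inner ℝ (circlePoint φ) (q ⟨j, hj⟩) * ‖u‖ := by
        gcongr
        linarith [hinner.2]
    _ = inner ℝ u (q ⟨j, hj⟩) := by
        conv_rhs => rw [← hφ, real_inner_smul_left, mul_comm]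

theorem norm_le_of_dist_circlePoint_le {y : Plane} {θ : ℝ} (h : dist y (circlePoint θ) ≤ δ) :
    ‖y‖ ≤ 1 + δ := by
  linarith [norm_le_norm_add_norm_sub' y (circlePoint θ), norm_circlePoint θ,
    dist_eq_norm y (circlePoint θ)]

end PerturbedRegularPolygon

section AlignedPolygon

/-- A point of `m⁻¹ ℤ²` close to `v` with numerators congruent to `(1, 0)` modulo `4`. -/
noncomputable def alignedRounding (m : ℕ) (v : Plane) : Plane :=
  !₂[(1 + 4 * round ((m * v 0 - 1) / 4) : ℤ) / m, (4 * round (m * v 1 / 4) : ℤ) / m]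

theorem isAligned_alignedRounding (m : ℕ) (v : Plane) : IsAligned m (alignedRounding m v) :=
  ⟨_, _, Int.modEq_iff_dvd.2 ⟨-round ((m * v 0 - 1) / 4), by ring⟩,
    Int.modEq_iff_dvd.2 ⟨-round (m * v 1 / 4), by ring⟩, rfl, rfl⟩

theorem dist_alignedRounding_le {m : ℕ} (hm : 0 < m) (v : Plane) :
    dist (alignedRounding m v) v ≤ 4 / m := by
  have hm₀ : (0 : ℝ) < m := Nat.cast_pos.2 hm
  have hcoord {a t : ℝ} (h : |a - m * t| ≤ 2) : |a / m - t| ≤ 2 / m := by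
    rwa [div_sub' hm₀.ne', abs_div, abs_of_pos hm₀, div_le_div_iff_of_pos_right hm₀]
  have h0 : |alignedRounding m v 0 - v 0| ≤ 2 / m := by
    refine hcoord ?_
    have hround := abs_le.1 (abs_sub_round ((m * v 0 - 1) / 4))
    push_cast
    rw [abs_le]
    constructor <;> linarith
  have h1 : |alignedRounding m v 1 - v 1| ≤ 2 / m := by
    refine hcoord ?_
    have hround := abs_le.1 (abs_sub_round (m * v 1 / 4))
    push_cast
    rw [abs_le]
    constructor <;> linarith
  rw [EuclideanSpace.dist_eq, Fin.sum_univ_two, Real.dist_eq, Real.dist_eq]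
  refine Real.sqrt_le_iff.2 ⟨by positivity, ?_⟩
  calc |alignedRounding m v 0 - v 0| ^ 2 + |alignedRounding m v 1 - v 1| ^ 2
      ≤ (2 / m) ^ 2 + (2 / m) ^ 2 := by gcongr
    _ ≤ (4 / m : ℝ) ^ 2 := by
        rw [div_pow, div_pow, ← add_div]
        gcongr
        norm_num

/-- The `j`-th vertex of the regular `k`-gon, rounded to `(4 k²)⁻¹ ℤ²`. The mesh is chosen so that
rounding moves vertices by at most `1 / k²`, which is too little to destroy convexity. -/
noncomputable def alignedVertex (k : ℕ) (j : Fin k) : Plane :=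
  alignedRounding (4 * k ^ 2) (circlePoint (vertexAngle k j))

/-- The vertices of the regular `k`-gon, rounded to `(4 k²)⁻¹ ℤ²`. -/
noncomputable def alignedPolygon (k : ℕ) : Finset Plane :=
  Finset.univ.image (alignedVertex k)

theorem coe_alignedPolygon (k : ℕ) :
    (alignedPolygon k : Set Plane) = Set.range (alignedVertex k) := by
  simp [alignedPolygon]

theorem dist_alignedVertex_le {k : ℕ} (j : Fin k) :
    dist (alignedVertex k j) (circlePoint (vertexAngle k j)) ≤ 1 / (k : ℝ) ^ 2 := by
  have hk := j.pos
  refine (dist_alignedRounding_le (by positivity) _).trans_eq ?_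
  push_cast
  field_simp

theorem convexIndependent_alignedVertex (k : ℕ) : ConvexIndependent ℝ (alignedVertex k) := by
  refine convexIndependent_of_dist_circlePoint_lt fun j => (dist_alignedVertex_le j).trans_lt ?_
  have hk := j.pos
  gcongr
  norm_num

theorem isConvexPolygonVertexSet_alignedPolygon {k : ℕ} (hk : 3 ≤ k) :
    IsConvexPolygonVertexSet k (alignedPolygon k) := by
  have hconv := convexIndependent_alignedVertex k
  refine ⟨hk, ?_, ?_⟩
  · rw [alignedPolygon, Finset.card_image_of_injective _ hconv.injective, Finset.card_fin]
  · have hrange := hconv.range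
    rwa [← coe_alignedPolygon] at hrange

theorem isAligned_of_mem_alignedPolygon {k : ℕ} {v : Plane} (hv : v ∈ alignedPolygon k) :
    IsAligned (4 * k ^ 2) v := by
  obtain ⟨j, -, rfl⟩ := Finset.mem_image.1 hv
  exact isAligned_alignedRounding _ _

theorem norm_le_of_mem_alignedPolygon {k : ℕ} {v : Plane} (hv : v ∈ alignedPolygon k) :
    ‖v‖ ≤ 1 + 1 / (k : ℝ) ^ 2 := by
  obtain ⟨j, -, rfl⟩ := Finset.mem_image.1 hv
  exact norm_le_of_dist_circlePoint_le (dist_alignedVertex_le j)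

theorem closedBall_subset_convexHull_alignedPolygon {k : ℕ} (hk : 0 < k) :
    Metric.closedBall 0 (1 - 6 / (k : ℝ) ^ 2) ⊆ convexHull ℝ (alignedPolygon k : Set Plane) := by
  have hball := closedBall_subset_convexHull_of_dist_circlePoint_le hk
    (dist_alignedVertex_le (k := k))
  rwa [← add_div, ← coe_alignedPolygon, show (5 + 1 : ℝ) = 6 by norm_num] at hball

theorem convexHull_alignedPolygon_subset_closedBall (k : ℕ) :
    convexHull ℝ (alignedPolygon k : Set Plane) ⊆ Metric.closedBall 0 (1 + 6 / (k : ℝ) ^ 2) := by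
  refine convexHull_min (fun v hv => mem_closedBall_zero_iff.2 ?_) (convex_closedBall _ _)
  refine (norm_le_of_mem_alignedPolygon hv).trans ?_
  gcongr
  norm_num

theorem six_div_sq_lt_one {k : ℕ} (hk : 3 ≤ k) : 6 / (k : ℝ) ^ 2 < 1 := by
  have hk₃ : (3 : ℝ) ≤ k := by exact_mod_cast hk
  rw [div_lt_one (by positivity)]
  nlinarith

theorem zero_mem_interior_convexHull_alignedPolygon {k : ℕ} (hk : 3 ≤ k) :
    (0 : Plane) ∈ interior (convexHull ℝ (alignedPolygon k : Set Plane)) :=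
  mem_interior_iff_mem_nhds.2 (Filter.mem_of_superset
    (Metric.closedBall_mem_nhds _ (sub_pos.2 (six_div_sq_lt_one hk)))
    (closedBall_subset_convexHull_alignedPolygon (by omega)))

theorem tendsto_hausdorffEDist_polygon_alignedPolygon :
    Tendsto (fun k => Metric.hausdorffEDist (polygon (alignedPolygon k)) (Metric.sphere 0 1))
      atTop (𝓝 0) := by
  have hlim : Tendsto (fun k : ℕ => ENNReal.ofReal (6 / (k : ℝ) ^ 2)) atTop (𝓝 0) := by
    rw [← ENNReal.ofReal_zero]
    exact (ENNReal.continuous_ofReal.tendsto 0).comp (tendsto_const_nhds.div_atTop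
      ((tendsto_pow_atTop two_ne_zero).comp tendsto_natCast_atTop_atTop))
  refine tendsto_of_tendsto_of_tendsto_of_le_of_le' tendsto_const_nhds hlim
    (Eventually.of_forall fun _ => zero_le) ?_
  filter_upwards [eventually_ge_atTop 3] with k hk
  exact hausdorffEDist_frontier_sphere_le (six_div_sq_lt_one hk)
    (closedBall_subset_convexHull_alignedPolygon (by omega))
    (convexHull_alignedPolygon_subset_closedBall k)

theorem containsCopyCenteredAt_alignedPolygon {k : ℕ} (hk : 0 < k) {x : Plane}
    (hx : ∀ i, |x i| ≤ 1) :
    ContainsCopyCenteredAt (nearGridCube 2 (256 * k ^ 2)) (alignedPolygon k) x := by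
  have hk₁ : (1 : ℝ) ≤ (k : ℝ) ^ 2 := one_le_pow₀ (by exact_mod_cast hk)
  refine containsCopyCenteredAt_nearGridCube (m := 4 * k ^ 2) (r := 2) (by positivity)
    (by linarith) ?_ (fun v hv => ⟨isAligned_of_mem_alignedPolygon hv, ?_⟩) hx
  · push_cast
    linarith
  · linarith [norm_le_of_mem_alignedPolygon hv, div_le_one_of_le₀ hk₁ (by positivity)]

theorem minkowskiDim_nearGridCube_two_le {k : ℕ} (hk : 3 ≤ k) :
    minkowskiDim (nearGridCube 2 (256 * (k : ℝ) ^ 2)) ≤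
      ((2 - Real.log (4 / 3) / 4 / Real.log k : ℝ) : EReal) := by
  have hk₃ : (3 : ℝ) ≤ k := by exact_mod_cast hk
  have hN : 6 ≤ 256 * (k : ℝ) ^ 2 := by nlinarith
  have hlog : Real.log (256 * (k : ℝ) ^ 2) ≤ 8 * Real.log k := by
    calc Real.log (256 * (k : ℝ) ^ 2) ≤ Real.log ((k : ℝ) ^ 6 * (k : ℝ) ^ 2) := by
          gcongr
          calc (256 : ℝ) ≤ 3 ^ 6 := by norm_num
            _ ≤ (k : ℝ) ^ 6 := by gcongr
      _ = 8 * Real.log k := by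
          rw [← pow_add, Real.log_pow]
          norm_num
  have hlog₀ : 0 < Real.log (256 * (k : ℝ) ^ 2) := Real.log_pos (by linarith)
  refine (minkowskiDim_nearGridCube_le 2 hN).trans (EReal.coe_le_coe_iff.2 ?_)
  calc ((2 : ℕ) : ℝ) - (2 : ℕ) * Real.log (4 / 3) / Real.log (256 * (k : ℝ) ^ 2)
      ≤ 2 - 2 * Real.log (4 / 3) / (8 * Real.log k) := by
        push_cast
        gcongr
    _ = 2 - Real.log (4 / 3) / 4 / Real.log k := by
        ring

end AlignedPolygon

theorem mainTheorem8 :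
    ∃ c : ℝ, 0 < c ∧ ∃ (V : ℕ → Finset Plane) (B : ℕ → Set Plane),
      (∀ k : ℕ, 3 ≤ k →
        IsConvexPolygonVertexSet k (V k) ∧ IsLatticeSet (V k) ∧
          (0 : Plane) ∈ interior (convexHull ℝ (V k : Set Plane))) ∧
      Tendsto (fun k : ℕ => Metric.hausdorffEDist (polygon (V k)) (Metric.sphere (0 : Plane) 1))
        atTop (𝓝 0) ∧
      ∀ k : ℕ, 3 ≤ k →
        Bornology.IsBounded (B k) ∧
          (∀ x : Plane, (∀ i, x i ∈ Set.Icc (0 : ℝ) 1) → ContainsCopyCenteredAt (B k) (V k) x) ∧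
          minkowskiDim (B k) ≤ ((2 - c / Real.log (k : ℝ) : ℝ) : EReal) := by
  refine ⟨Real.log (4 / 3) / 4, div_pos (Real.log_pos (by norm_num)) (by norm_num),
    alignedPolygon, fun k => nearGridCube 2 (256 * (k : ℝ) ^ 2), fun k hk => ⟨?_, ?_, ?_⟩,
    tendsto_hausdorffEDist_polygon_alignedPolygon, fun k hk => ⟨?_, fun x hx => ?_, ?_⟩⟩
  · exact isConvexPolygonVertexSet_alignedPolygon hk
  · exact isLatticeSet_of_isAligned (by positivity) fun _ => isAligned_of_mem_alignedPolygon
  · exact zero_mem_interior_convexHull_alignedPolygon hk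
  · exact isBounded_nearGridCube 2 _
  · exact containsCopyCenteredAt_alignedPolygon (by omega) fun i =>
      abs_le.2 ⟨by linarith [(hx i).1], (hx i).2⟩
  · exact minkowskiDim_nearGridCube_two_le hk
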